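/- A simplicial manifold is a simplicial object $X_\bullet$ in the category of smooth manifolds (each $X_n$ is Hausdorff, second countable, without boundary and of some finite dimension depending on $n$). Its base $X_0$ is embedded in every $X_n$ by the degenerate map $(s_0)^n$ induced by the unique map $[n]\to[0]$; these embeddings are compatible with all structure maps, so for $x_0\in X_0$ the tangent spaces $T_{x_0}X_n$ form a simplicial vector space $T_{x_0}X_\bullet$. For a simplicial vector space $V_\bullet$ let $N(V)$ be the normalized chain complex with $N(V)_0=V_0$, $N(V)_n=\bigcap_{j=0}^{n-1}\ker(d_j:V_n\to V_{n-1})$ for $n\ge 1$, and $\partial_n=(-1)^n d_n$. Let $\mathrm{sMfd}$ be the category of simplicial manifolds and simplicial smooth maps, and let $\mathrm{VBChain}$ be the category of non-negatively graded chain complexes of smooth vector bundles over smooth manifolds, whose differentials are smooth vector bundle morphisms over the identity and whose morphisms are families of smooth vector bundle morphisms covering one smooth map of the bases and commuting with the differentials. Proposition. Assigning the tangent complex is a functor $\mathfrak T:\mathrm{sMfd}\to\mathrm{VBChain}$. That is: (1) For every simplicial manifold $X_\bullet$ and every $n\ge 0$, the set $\mathfrak T_n(X)=\bigsqcup_{x_0\in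 X_0}N(T_{x_0}X_\bullet)_n$, which is $\bigsqcup_{x_0} T_{x_0}X_0=TX_0$ for $n=0$ and $\bigcap_{j=0}^{n-1}\ker\bigl(Td_j:TX_n|_{X_0}\to TX_{n-1}|_{X_0}\bigr)$ for $n\ge1$, carries the structure of a smooth vector bundle over $X_0$ making it a smooth vector subbundle of $TX_n|_{X_0}$. (2) The maps $\partial_n=(-1)^nTd_n$ restrict to smooth vector bundle morphisms $\mathfrak T_n(X)\to\mathfrak T_{n-1}(X)$ over $\mathrm{id}_{X_0}$ with $\partial_n\partial_{n+1}=0$, so that $(\mathfrak T_\bullet(X),\partial_\bullet)$ is an object of $\mathrm{VBChain}$. (3) For every simplicial smooth map $f:X_\bullet\to Y_\bullet$ the tangent maps $Tf_n$ restrict to smooth vector bundle morphisms $\mathfrak T_n(f):\mathfrak T_n(X)\to\mathfrak T_n(Y)$ covering $f_0$ and commuting with the differentials, and $X\mapsto\mathfrak T(X)$, $f\mapsto\mathfrak T(f)$ is a functor $\mathrm{sMfd}\to\mathrm{VBChain}$. -/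

import Mathlib

open CategoryTheory Opposite Bundle
open scoped Manifold ContDiff Simplicial

universe u

noncomputable section

/-! ### Smooth manifolds and simplicial manifolds -/

/-- A smooth manifold: Hausdorff, second countable, without boundary, finite dimensional, `C^∞`. -/
structure SmoothMfd : Type (u + 1) where
  carrier : Type u
  dim : ℕ
  [topology : TopologicalSpace carrier]
  [charted : ChartedSpace (EuclideanSpace ℝ (Fin dim)) carrier]
  [smooth : IsManifold (𝓡 dim) ∞ carrier]
  [hausdorff : T2Space carrier]
  [secondCountable : SecondCountableTopology carrier]

namespace SmoothMfd

instance : CoeSort SmoothMfd.{u} (Type u) := ⟨SmoothMfd.carrier⟩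

attribute [instance] topology charted smooth hausdorff secondCountable

/-- Morphisms of smooth manifolds are smooth maps. -/
structure Hom (M N : SmoothMfd.{u}) : Type u where
  toFun : M → N
  contMDiff : ContMDiff (𝓡 M.dim) (𝓡 N.dim) ∞ toFun

instance : Category SmoothMfd.{u} where
  Hom := Hom
  id M := ⟨fun x => x, contMDiff_id⟩
  comp f g := ⟨fun x => g.toFun (f.toFun x), g.contMDiff.comp f.contMDiff⟩

/-- The tangent space `T_x M`. -/
abbrev Tan (M : SmoothMfd.{u}) (x : M) : Type := TangentSpace (𝓡 M.dim) x

/-- For `f : M ⟶ N` and points with `f x = y`, the tangent map `T_x f : T_x M → T_y N`. -/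
def tangentMapAt {M N : SmoothMfd.{u}} (f : M ⟶ N) {x : M} {y : N} (h : f.toFun x = y) :
    M.Tan x →ₗ[ℝ] N.Tan y :=
  h ▸ (mfderiv (𝓡 M.dim) (𝓡 N.dim) f.toFun x).toLinearMap

theorem tangentMapAt_id (M : SmoothMfd.{u}) {x : M} (h : (𝟙 M : M ⟶ M).toFun x = x) :
    tangentMapAt (𝟙 M) h = LinearMap.id := by
  change (mfderiv (𝓡 M.dim) (𝓡 M.dim) (@id M) x).toLinearMap = LinearMap.id
  rw [mfderiv_id]; rfl

theorem tangentMapAt_comp {M N P : SmoothMfd.{u}} (f : M ⟶ N) (g : N ⟶ P) {x : M} {y : N} {z : P}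
    (hf : f.toFun x = y) (hg : g.toFun y = z) (h : (f ≫ g).toFun x = z) :
    tangentMapAt (f ≫ g) h = (tangentMapAt g hg).comp (tangentMapAt f hf) := by
  subst hf; subst hg
  change (mfderiv (𝓡 M.dim) (𝓡 P.dim) (g.toFun ∘ f.toFun) x).toLinearMap = _
  rw [mfderiv_comp x (g.contMDiff.mdifferentiableAt (by simp))
    (f.contMDiff.mdifferentiableAt (by simp))]
  rfl

theorem tangentMapAt_congr {M N : SmoothMfd.{u}} {f g : M ⟶ N} (e : f = g) {x : M} {y : N}
    (hf : f.toFun x = y) (hg : g.toFun x = y) : tangentMapAt f hf = tangentMapAt g hg := by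
  subst e; rfl

end SmoothMfd

/-- Simplicial manifolds: simplicial objects in the category of smooth manifolds. -/
abbrev SMfd : Type (u + 1) := SimplicialObject SmoothMfd.{u}

/-! ### The normalized chain complex of a simplicial vector space -/

section Normalization

/-- `N_n(V) = ⋂_{j < n} ker (d_j : V_n → V_{n-1})`, and `N_0(V) = V_0`. -/
def normalizedSubmodule (V : SimplicialObject (ModuleCat.{0} ℝ)) :
    (n : ℕ) → Submodule ℝ (V.obj (op ⦋n⦌) : ModuleCat.{0} ℝ) := fun n => match n with
  | 0 => ⊤
  | n + 1 => ⨅ j : Fin (n + 1), LinearMap.ker (V.δ j.castSucc).hom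

theorem mem_normalizedSubmodule_succ (V : SimplicialObject (ModuleCat.{0} ℝ)) (n : ℕ)
    (v : V.obj (op ⦋n + 1⦌)) :
    v ∈ normalizedSubmodule V (n + 1) ↔ ∀ j : Fin (n + 1), (V.δ j.castSucc).hom v = 0 := by
  simp [normalizedSubmodule]

theorem normalized_d_mem (V : SimplicialObject (ModuleCat.{0} ℝ)) (n : ℕ)
    (v : V.obj (op ⦋n + 1⦌)) (hv : v ∈ normalizedSubmodule V (n + 1)) :
    ((-1 : ℝ) ^ (n + 1) • (V.δ (Fin.last (n + 1))).hom) v ∈ normalizedSubmodule V n := by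
  cases n with
  | zero => trivial
  | succ n =>
    rw [mem_normalizedSubmodule_succ] at hv ⊢
    intro j
    have h := congrArg (fun f => f.hom v)
      (V.δ_comp_δ (i := j.castSucc) (j := Fin.last (n + 1)) (Fin.le_last _))
    have h' : (V.δ j.castSucc).hom ((V.δ (Fin.last (n + 2))).hom v)
        = (V.δ (Fin.last (n + 1))).hom ((V.δ j.castSucc.castSucc).hom v) := h
    rw [LinearMap.smul_apply, map_smul, h', hv j.castSucc, map_zero, smul_zero]

/-- The differential `∂_{n+1} = (-1)^{n+1} d_{n+1} : N_{n+1}(V) → N_n(V)`. -/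
def normalizedD (V : SimplicialObject (ModuleCat.{0} ℝ)) (n : ℕ) :
    normalizedSubmodule V (n + 1) →ₗ[ℝ] normalizedSubmodule V n :=
  ((-1 : ℝ) ^ (n + 1) • (V.δ (Fin.last (n + 1))).hom).restrict (normalized_d_mem V n)

theorem normalizedD_comp (V : SimplicialObject (ModuleCat.{0} ℝ)) (n : ℕ) :
    (normalizedD V n).comp (normalizedD V (n + 1)) = 0 := by
  ext ⟨v, hv⟩
  have h := congrArg (fun f => f.hom v)
    (V.δ_comp_δ (i := Fin.last (n + 1)) (j := Fin.last (n + 1)) le_rfl)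
  have h' : (V.δ (Fin.last (n + 1))).hom ((V.δ (Fin.last (n + 2))).hom v)
      = (V.δ (Fin.last (n + 1))).hom ((V.δ (Fin.last (n + 1)).castSucc).hom v) := h
  change (-1 : ℝ) ^ (n + 1) • (V.δ (Fin.last (n + 1))).hom
    ((-1 : ℝ) ^ (n + 1 + 1) • (V.δ (Fin.last (n + 2))).hom v) = 0
  rw [map_smul, h', (mem_normalizedSubmodule_succ V (n + 1) v).1 hv, map_zero, smul_zero, smul_zero]

theorem normalized_map_mem {V W : SimplicialObject (ModuleCat.{0} ℝ)} (f : V ⟶ W) (n : ℕ)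
    (v : V.obj (op ⦋n⦌)) (hv : v ∈ normalizedSubmodule V n) :
    (f.app (op ⦋n⦌)).hom v ∈ normalizedSubmodule W n := by
  cases n with
  | zero => trivial
  | succ n =>
    rw [mem_normalizedSubmodule_succ] at hv ⊢
    intro j
    have h := congrArg (fun g => g.hom v) (SimplicialObject.δ_naturality f j.castSucc)
    have h' : (f.app (op ⦋n⦌)).hom ((V.δ j.castSucc).hom v)
        = (W.δ j.castSucc).hom ((f.app (op ⦋n + 1⦌)).hom v) := h
    rw [← h', hv j, map_zero]

/-- The normalized chain complex of a simplicial vector space. -/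
def normalizedChain (V : SimplicialObject (ModuleCat.{0} ℝ)) : ChainComplex (ModuleCat.{0} ℝ) ℕ :=
  ChainComplex.of (fun n => ModuleCat.of ℝ (normalizedSubmodule V n))
    (fun n => ModuleCat.ofHom (normalizedD V n))
    (fun n => ModuleCat.hom_ext (normalizedD_comp V n))

theorem normalizedChain_d (V : SimplicialObject (ModuleCat.{0} ℝ)) (n : ℕ) :
    (normalizedChain V).d (n + 1) n = ModuleCat.ofHom (normalizedD V n) :=
  ChainComplex.of_d (fun n => ModuleCat.of ℝ (normalizedSubmodule V n))
    (fun n => ModuleCat.ofHom (normalizedD V n)) n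

/-- The normalized chain complex functor `N : sVect ⥤ Ch_{≥ 0}(Vect)`. -/
def normalizedComplex :
    SimplicialObject (ModuleCat.{0} ℝ) ⥤ ChainComplex (ModuleCat.{0} ℝ) ℕ where
  obj V := normalizedChain V
  map {V W} f := ChainComplex.ofHom
    (fun n => ModuleCat.ofHom ((f.app (op ⦋n⦌)).hom.restrict (normalized_map_mem f n)))
    (fun n => by
      rw [normalizedChain_d, normalizedChain_d]
      apply ModuleCat.hom_ext
      apply LinearMap.ext
      rintro ⟨v, hv⟩
      have h := congrArg (fun g => g.hom v) (SimplicialObject.δ_naturality f (Fin.last (n + 1)))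
      have h' : (f.app (op ⦋n⦌)).hom ((V.δ (Fin.last (n + 1))).hom v)
          = (W.δ (Fin.last (n + 1))).hom ((f.app (op ⦋n + 1⦌)).hom v) := h
      apply Subtype.ext
      change (-1 : ℝ) ^ (n + 1) • (W.δ (Fin.last (n + 1))).hom ((f.app (op ⦋n + 1⦌)).hom v)
        = (f.app (op ⦋n⦌)).hom ((-1 : ℝ) ^ (n + 1) • (V.δ (Fin.last (n + 1))).hom v)
      rw [map_smul, h'])
  map_id V := by
    apply HomologicalComplex.hom_ext
    intro n
    rfl
  map_comp f g := by
    apply HomologicalComplex.hom_ext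
    intro n
    rfl

/-- The inclusion `N_n(V) ⊆ V_n`. -/
def normalizedInclusion (V : SimplicialObject (ModuleCat.{0} ℝ)) (n : ℕ) :
    (normalizedComplex.obj V).X n →ₗ[ℝ] V.obj (op ⦋n⦌) :=
  (normalizedSubmodule V n).subtype

end Normalization

/-! ### The simplicial vector spaces `T_{x₀} X_•` -/

namespace SMfd

/-- The base space `X_0`. -/
abbrev base (X : SMfd.{u}) : SmoothMfd.{u} := X.obj (op ⦋0⦌)

/-- The unique embedding `X_0 → X_k` by degeneracies, induced by the unique map `[k] → [0]`. -/
def baseMap (X : SMfd.{u}) (k : SimplexCategoryᵒᵖ) : X.base ⟶ X.obj k :=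
  X.map (SimplexCategory.isTerminalZero.from k.unop).op

theorem baseMap_map (X : SMfd.{u}) {k l : SimplexCategoryᵒᵖ} (θ : k ⟶ l) (x : X.base) :
    (X.map θ).toFun ((X.baseMap k).toFun x) = (X.baseMap l).toFun x := by
  have h : X.baseMap k ≫ X.map θ = X.baseMap l := by
    unfold baseMap
    rw [← X.map_comp]
    congr 1
  exact congrArg (fun f => f.toFun x) h

theorem baseMap_naturality {X Y : SMfd.{u}} (f : X ⟶ Y) (k : SimplexCategoryᵒᵖ) (x : X.base) :
    (f.app k).toFun ((X.baseMap k).toFun x)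
      = (Y.baseMap k).toFun ((f.app (op ⦋0⦌)).toFun x) :=
  congrArg (fun g => g.toFun x) (f.naturality (SimplexCategory.isTerminalZero.from k.unop).op)

/-- The simplicial vector space `T_{x₀} X_•`, whose structure maps are the tangent maps of the
structure maps of `X` (here `x₀` is identified with its images in all the `X_k`). -/
def tangentAt (X : SMfd.{u}) (x : X.base) : SimplicialObject (ModuleCat.{0} ℝ) where
  obj k := ModuleCat.of ℝ ((X.obj k).Tan ((X.baseMap k).toFun x))
  map θ := ModuleCat.ofHom (SmoothMfd.tangentMapAt (X.map θ) (X.baseMap_map θ x))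
  map_id k := by
    apply ModuleCat.hom_ext
    exact (SmoothMfd.tangentMapAt_congr (X.map_id k) _ rfl).trans (SmoothMfd.tangentMapAt_id _ _)
  map_comp {k l m} θ η := by
    apply ModuleCat.hom_ext
    have h : (X.map θ ≫ X.map η).toFun ((X.baseMap k).toFun x) = (X.baseMap m).toFun x := by
      rw [← X.map_comp]; exact X.baseMap_map _ x
    refine (SmoothMfd.tangentMapAt_congr (X.map_comp θ η) _ h).trans ?_
    exact SmoothMfd.tangentMapAt_comp _ _ _ _ _

/-- The map of simplicial vector spaces `T_{x₀} X_• → T_{f x₀} Y_•` induced by `f : X ⟶ Y`. -/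
def tangentAtMap {X Y : SMfd.{u}} (f : X ⟶ Y) (x : X.base) :
    X.tangentAt x ⟶ Y.tangentAt ((f.app (op ⦋0⦌)).toFun x) where
  app k := ModuleCat.ofHom (SmoothMfd.tangentMapAt (f.app k) (baseMap_naturality f k x))
  naturality {k l} θ := by
    apply ModuleCat.hom_ext
    have h₁ : (X.map θ ≫ f.app l).toFun ((X.baseMap k).toFun x)
        = (Y.baseMap l).toFun ((f.app (op ⦋0⦌)).toFun x) := by
      rw [← baseMap_naturality, ← X.baseMap_map θ x]; rfl
    have h₂ : (f.app k ≫ Y.map θ).toFun ((X.baseMap k).toFun x)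
        = (Y.baseMap l).toFun ((f.app (op ⦋0⦌)).toFun x) := by
      rw [← f.naturality]; exact h₁
    refine (SmoothMfd.tangentMapAt_comp _ _ (X.baseMap_map θ x)
      (baseMap_naturality f l x) h₁).symm.trans ?_
    refine (SmoothMfd.tangentMapAt_congr (f.naturality θ) h₁ h₂).trans ?_
    exact SmoothMfd.tangentMapAt_comp _ _ _ _ _

theorem tangentAtMap_id (X : SMfd.{u}) (x : X.base) :
    tangentAtMap (𝟙 X) x = 𝟙 (X.tangentAt x) := by
  apply NatTrans.ext
  funext k
  exact ModuleCat.hom_ext (SmoothMfd.tangentMapAt_id (X.obj k) rfl)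

theorem tangentAtMap_comp {X Y Z : SMfd.{u}} (f : X ⟶ Y) (g : Y ⟶ Z) (x : X.base) :
    tangentAtMap (f ≫ g) x
      = tangentAtMap f x ≫ tangentAtMap g ((f.app (op ⦋0⦌)).toFun x) := by
  apply NatTrans.ext
  funext k
  exact ModuleCat.hom_ext (SmoothMfd.tangentMapAt_comp _ _ _ _ _)

end SMfd

/-! ### Families of chain complexes over manifolds, without smoothness in the fibres -/

/-- A family of chain complexes of real vector spaces indexed by the points of a manifold. -/
structure ChainFamily : Type (u + 1) where
  base : SmoothMfd.{u}
  complex : base → ChainComplex (ModuleCat.{0} ℝ) ℕ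

namespace ChainFamily

/-- A smooth map of the bases with chain maps between the fibres covering it. -/
@[ext]
structure Hom (C D : ChainFamily.{u}) : Type u where
  base : C.base ⟶ D.base
  fiber : (x : C.base) → (C.complex x ⟶ D.complex (base.toFun x))

instance : Category ChainFamily.{u} where
  Hom := Hom
  id C := ⟨𝟙 C.base, fun x => 𝟙 (C.complex x)⟩
  comp f g := ⟨f.base ≫ g.base, fun x => f.fiber x ≫ g.fiber (f.base.toFun x)⟩
  id_comp _ := Hom.ext rfl (heq_of_eq (funext fun _ => Category.id_comp _))
  comp_id _ := Hom.ext rfl (heq_of_eq (funext fun _ => Category.comp_id _))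
  assoc _ _ _ := Hom.ext rfl (heq_of_eq (funext fun _ => Category.assoc _ _ _))

end ChainFamily

/-- The pointwise tangent complex: `X ↦ (N(T_{x₀} X_•))_{x₀ ∈ X_0}`, with `∂_n = (-1)^n T d_n`, and
with `f : X ⟶ Y` acting by the restrictions of the tangent maps `T f_n`. -/
def pointwiseTangentComplex : SMfd.{u} ⥤ ChainFamily.{u} where
  obj X := ⟨X.base, fun x => normalizedComplex.obj (X.tangentAt x)⟩
  map f := ⟨f.app (op ⦋0⦌), fun x => normalizedComplex.map (SMfd.tangentAtMap f x)⟩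
  map_id X := ChainFamily.Hom.ext rfl (heq_of_eq (funext fun x =>
    (congrArg normalizedComplex.map (SMfd.tangentAtMap_id X x)).trans
      (normalizedComplex.map_id _)))
  map_comp f g := ChainFamily.Hom.ext rfl (heq_of_eq (funext fun x =>
    (congrArg normalizedComplex.map (SMfd.tangentAtMap_comp f g x)).trans
      (normalizedComplex.map_comp _ _)))

/-! ### Smooth vector bundles and chain complexes of them -/

/-- The structure of a smooth (finite rank, real) vector bundle over `M` on a family of vector
spaces `E x`, `x ∈ M`. -/
structure VectorBundleOn (M : SmoothMfd.{u}) (E : M → Type)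
    [∀ x, AddCommGroup (E x)] [∀ x, Module ℝ (E x)] : Type u where
  rank : ℕ
  [fiberTopology : ∀ x, TopologicalSpace (E x)]
  [totalTopology : TopologicalSpace (TotalSpace (EuclideanSpace ℝ (Fin rank)) E)]
  [fiberBundle : FiberBundle (EuclideanSpace ℝ (Fin rank)) E]
  [vectorBundle : VectorBundle ℝ (EuclideanSpace ℝ (Fin rank)) E]
  [smooth : ContMDiffVectorBundle ∞ (EuclideanSpace ℝ (Fin rank)) E (𝓡 M.dim)]

namespace VectorBundleOn

section

variable {M N : SmoothMfd.{u}}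
  {E : M → Type} [∀ x, AddCommGroup (E x)] [∀ x, Module ℝ (E x)]
  {E' : N → Type} [∀ x, AddCommGroup (E' x)] [∀ x, Module ℝ (E' x)]

/-- The total space of a vector bundle. -/
abbrev Total (S : VectorBundleOn M E) : Type u :=
  TotalSpace (EuclideanSpace ℝ (Fin S.rank)) E

/-- The map of total spaces given by a map `f` of the bases and linear maps of the fibres. -/
def totalMap (S : VectorBundleOn M E) (S' : VectorBundleOn N E') (f : M → N)
    (φ : ∀ x, E x →ₗ[ℝ] E' (f x)) (p : S.Total) : S'.Total :=
  ⟨f p.proj, φ p.proj p.snd⟩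

/-- The fibrewise linear map `φ` covering `f` is smooth, that is, a vector bundle morphism. -/
def IsSmoothMap (S : VectorBundleOn M E) (S' : VectorBundleOn N E') (f : M → N)
    (φ : ∀ x, E x →ₗ[ℝ] E' (f x)) : Prop :=
  letI := S.fiberTopology
  letI := S.totalTopology
  letI := S.fiberBundle
  letI := S'.fiberTopology
  letI := S'.totalTopology
  letI := S'.fiberBundle
  ContMDiff ((𝓡 M.dim).prod 𝓘(ℝ, EuclideanSpace ℝ (Fin S.rank)))
    ((𝓡 N.dim).prod 𝓘(ℝ, EuclideanSpace ℝ (Fin S'.rank))) ∞ (S.totalMap S' f φ)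

theorem isSmoothMap_id (S : VectorBundleOn M E) :
    S.IsSmoothMap S (fun x => x) (fun _ => LinearMap.id) :=
  letI := S.fiberTopology
  letI := S.totalTopology
  letI := S.fiberBundle
  contMDiff_id

theorem IsSmoothMap.comp {P : SmoothMfd.{u}}
    {E'' : P → Type} [∀ x, AddCommGroup (E'' x)] [∀ x, Module ℝ (E'' x)]
    {S : VectorBundleOn M E} {S' : VectorBundleOn N E'} {S'' : VectorBundleOn P E''}
    {f : M → N} {g : N → P} {φ : ∀ x, E x →ₗ[ℝ] E' (f x)} {ψ : ∀ y, E' y →ₗ[ℝ] E'' (g y)}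
    (hφ : S.IsSmoothMap S' f φ) (hψ : S'.IsSmoothMap S'' g ψ) :
    S.IsSmoothMap S'' (fun x => g (f x)) (fun x => (ψ (f x)).comp (φ x)) :=
  letI := S.fiberTopology
  letI := S.totalTopology
  letI := S.fiberBundle
  letI := S'.fiberTopology
  letI := S'.totalTopology
  letI := S'.fiberBundle
  letI := S''.fiberTopology
  letI := S''.totalTopology
  letI := S''.fiberBundle
  ContMDiff.comp hψ hφ

end

/-- The vector bundle `S`, with fibres included in those of the vector bundle `T` over the same base
by the linear maps `j x`, is a smooth vector subbundle of `T`: the inclusion is fibrewise injective,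
a morphism of smooth vector bundles over the identity, and a topological embedding. -/
structure IsSubbundle {M : SmoothMfd.{u}}
    {E : M → Type} [∀ x, AddCommGroup (E x)] [∀ x, Module ℝ (E x)]
    {E' : M → Type} [∀ x, AddCommGroup (E' x)] [∀ x, Module ℝ (E' x)]
    (S : VectorBundleOn M E) (T : VectorBundleOn M E') (j : ∀ x, E x →ₗ[ℝ] E' x) : Prop where
  injective : ∀ x, Function.Injective (j x)
  isSmoothMap : S.IsSmoothMap T (fun x => x) j
  isEmbedding :
    letI := S.totalTopology
    letI := T.totalTopology
    Topology.IsEmbedding (S.totalMap T (fun x => x) j)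

end VectorBundleOn

/-- The smooth vector bundle `TX_n|_{X_0}` over `X_0`: the pullback of the tangent bundle of `X_n`
along the embedding `X_0 → X_n`. -/
def SMfd.restrictedTangentBundle (X : SMfd.{u}) (n : ℕ) :
    VectorBundleOn X.base (fun x => ((X.tangentAt x).obj (op ⦋n⦌) : ModuleCat.{0} ℝ)) :=
  let f : C^∞⟮𝓡 X.base.dim, X.base; 𝓡 (X.obj (op ⦋n⦌)).dim, X.obj (op ⦋n⦌)⟯ :=
    ⟨(X.baseMap (op ⦋n⦌)).toFun, (X.baseMap (op ⦋n⦌)).contMDiff⟩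
  let F := EuclideanSpace ℝ (Fin (X.obj (op ⦋n⦌)).dim)
  let E := (f : X.base → X.obj (op ⦋n⦌)) *ᵖ (X.obj (op ⦋n⦌)).Tan
  { rank := (X.obj (op ⦋n⦌)).dim
    fiberTopology := inferInstanceAs (∀ x, TopologicalSpace (E x))
    totalTopology := inferInstanceAs (TopologicalSpace (TotalSpace F E))
    fiberBundle := inferInstanceAs (FiberBundle F E)
    vectorBundle := inferInstanceAs (VectorBundle ℝ F E)
    smooth := inferInstanceAs (ContMDiffVectorBundle ∞ F E (𝓡 X.base.dim)) }

/-- Smooth vector bundle structures on the terms of a family of chain complexes, such that the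
differentials are vector bundle morphisms over the identity. -/
structure VBChainStructure (C : ChainFamily.{u}) : Type u where
  bundle : (n : ℕ) → VectorBundleOn C.base (fun x => (C.complex x).X n)
  d_smooth : ∀ n, (bundle (n + 1)).IsSmoothMap (bundle n) (fun x => x)
    (fun x => ((C.complex x).d (n + 1) n).hom)

/-- A chain complex of smooth vector bundles over a smooth manifold. -/
structure VBChainComplex : Type (u + 1) where
  family : ChainFamily.{u}
  str : VBChainStructure family

namespace VBChainComplex

/-- Morphisms of chain complexes of vector bundles: smooth vector bundle morphisms in each degree,
covering one smooth map of the bases and commuting with the differentials. -/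
@[ext]
structure Hom (C D : VBChainComplex.{u}) : Type u where
  hom : C.family ⟶ D.family
  smooth : ∀ n, (C.str.bundle n).IsSmoothMap (D.str.bundle n) hom.base.toFun
    (fun x => ((hom.fiber x).f n).hom)

instance : Category VBChainComplex.{u} where
  Hom := Hom
  id C := ⟨𝟙 C.family, fun n => (C.str.bundle n).isSmoothMap_id⟩
  comp f g := ⟨f.hom ≫ g.hom, fun n => (f.smooth n).comp (g.smooth n)⟩
  id_comp f := Hom.ext (Category.id_comp f.hom)
  comp_id f := Hom.ext (Category.comp_id f.hom)
  assoc f g h := Hom.ext (Category.assoc f.hom g.hom h.hom)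

/-- Forgetting the smooth structures of the bundles. -/
def forget : VBChainComplex.{u} ⥤ ChainFamily.{u} where
  obj C := C.family
  map f := f.hom

end VBChainComplex

end

/-! A common kernel of bundle maps need not have constant rank; here the degeneracies repair this.
Let `K n k` be the common kernel of the `d_j`, `j < k`, in degree `n` (`partialKer`). The simplicial
identities make `d_k : K (n+1) k → K n k` a surjection with section `s_k` and kernel `K (n+1)
(k+1)`. This has two consequences. First, `1 - s_k d_k` projects `K (n+1) k` onto `K (n+1) (k+1)`,
so iterating gives a smooth idempotent of `TX_n|_{X_0}` with image the normalized part
(`exists_projection_partialKer`). Second, `dim K (n+1) (k+1) = dim K (n+1) k - dim K n k`, so by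
induction the ranks depend only on the dimensions of the `X_m` and not on the point
(`exists_finrank_partialKer`).

The image of a smooth idempotent of constant rank is a smooth bundle with smooth inclusion `j` and
smooth retraction `q` (`SmoothRetract`, `exists_of_retract`): near `x`, projecting to the fibre at
`x` in a trivialization remains invertible. A map between such images that restricts a smooth bundle
map `φ` equals `q ∘ φ ∘ j`, hence is smooth; this covers the differentials and the `Tf_n`. The
algebraic identities and functoriality are already known pointwise. -/

noncomputable section

/-! ### Smooth families of linear maps -/

section SmoothFamilies

variable {EM HM M : Type*} [NormedAddCommGroup EM] [NormedSpace ℝ EM] [TopologicalSpace HM]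
  {IM : ModelWithCorners ℝ EM HM} [TopologicalSpace M] [ChartedSpace HM M] {n : ℕ∞ω}
  {F G : Type*} [NormedAddCommGroup F] [NormedSpace ℝ F] [FiniteDimensional ℝ F]
  [NormedAddCommGroup G] [NormedSpace ℝ G]

/-- A family of linear maps out of a finite dimensional space is smooth if it is so pointwise. -/
theorem contMDiffAt_toContinuousLinearMap {A : M → F →ₗ[ℝ] G} {x₀ : M}
    (h : ∀ v, ContMDiffAt IM 𝓘(ℝ, G) n (fun x => A x v) x₀) :
    ContMDiffAt IM 𝓘(ℝ, F →L[ℝ] G) n (fun x => (A x).toContinuousLinearMap) x₀ := by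
  let b := Module.finBasis ℝ F
  let c : Fin (Module.finrank ℝ F) → F →L[ℝ] ℝ := fun i => (b.coord i).toContinuousLinearMap
  -- In a basis, `A x` is the sum of the `c i ⊗ A x (b i)`, and each summand depends on the vector
  -- `A x (b i)` through a fixed continuous linear map.
  have e : (fun x => (A x).toContinuousLinearMap) =
      fun x => ∑ i, ContinuousLinearMap.smulRightL ℝ F G (c i) (A x (b i)) := by
    funext x
    ext v
    simp only [LinearMap.coe_toContinuousLinearMap', sum_apply,
      ContinuousLinearMap.smulRightL_apply_apply]
    conv_lhs => rw [← b.sum_repr v, map_sum]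
    simp [c]
  rw [e]
  refine ContMDiffAt.sum fun i _ => ?_
  exact (ContinuousLinearMap.smulRightL ℝ F G (c i)).contMDiff.contMDiffAt.comp x₀ (h (b i))

/-- The pointwise inverse of a smooth family of invertible endomorphisms is smooth. -/
theorem ContMDiffAt.clm_ringInverse {A : M → F →L[ℝ] F} {x₀ : M}
    (h : ContMDiffAt IM 𝓘(ℝ, F →L[ℝ] F) n A x₀) (hu : IsUnit (A x₀)) :
    ContMDiffAt IM 𝓘(ℝ, F →L[ℝ] F) n (fun x => Ring.inverse (A x)) x₀ := by
  obtain ⟨a, ha⟩ := hu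
  have := contDiffAt_ringInverse ℝ (n := n) a
  rw [ha] at this
  exact this.contMDiffAt.comp x₀ h

end SmoothFamilies

/-! ### Smooth retracts of vector bundles -/

section Retract

variable {EB HB B : Type*} [NormedAddCommGroup EB] [NormedSpace ℝ EB] [TopologicalSpace HB]
  (IB : ModelWithCorners ℝ EB HB) [TopologicalSpace B] [ChartedSpace HB B] (n : ℕ∞ω)
  (F : Type*) [NormedAddCommGroup F] [NormedSpace ℝ F]
  (V : B → Type*) [∀ x, AddCommGroup (V x)] [∀ x, Module ℝ (V x)] [∀ x, TopologicalSpace (V x)]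
  [TopologicalSpace (TotalSpace F V)] [FiberBundle F V]
  (G : Type*) [NormedAddCommGroup G] [NormedSpace ℝ G]
  (E : B → Type*) [∀ x, AddCommGroup (E x)] [∀ x, Module ℝ (E x)]

/-- A family `E` of vector spaces of constant dimension which is a fibrewise retract of the vector
bundle `V`, such that the resulting idempotent endomorphism of `V` is smooth. -/
structure SmoothRetract where
  incl : ∀ x, E x →ₗ[ℝ] V x
  retr : ∀ x, V x →ₗ[ℝ] E x
  retr_incl : ∀ x v, retr x (incl x v) = v
  equiv : ∀ x, E x ≃ₗ[ℝ] G
  smooth : ContMDiff (IB.prod 𝓘(ℝ, F)) (IB.prod 𝓘(ℝ, F)) n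
    (fun p : TotalSpace F V => (⟨p.proj, incl p.proj (retr p.proj p.snd)⟩ : TotalSpace F V))

namespace SmoothRetract

variable {IB n F V G E} [VectorBundle ℝ F V] (D : SmoothRetract IB n F V G E)

/-- The idempotent of `V` read in the trivializations at `x` and `y`. -/
def localIdem (x y b : B) : F →ₗ[ℝ] F :=
  (trivializationAt F V y).linearMapAt ℝ b ∘ₗ D.incl b ∘ₗ D.retr b ∘ₗ
    (trivializationAt F V x).symmₗ ℝ b

/-- The fibre at `x` as a subspace of the model fibre. -/
def modelIncl (x : B) : G →ₗ[ℝ] F :=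
  (trivializationAt F V x).linearMapAt ℝ x ∘ₗ D.incl x ∘ₗ (D.equiv x).symm.toLinearMap

/-- The projection of the model fibre to the fibre at `x`. -/
def modelRetr (x : B) : F →ₗ[ℝ] G :=
  (D.equiv x).toLinearMap ∘ₗ D.retr x ∘ₗ (trivializationAt F V x).symmₗ ℝ x

/-- The change from the frame at `x` to the coordinates at `y`. -/
def trans (x y b : B) : G →ₗ[ℝ] G :=
  D.modelRetr y ∘ₗ D.localIdem x y b ∘ₗ D.modelIncl x

/-- The coordinates on `E b` induced by the trivialization at `x`. -/
def fib (x b : B) : E b →ₗ[ℝ] G :=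
  D.modelRetr x ∘ₗ (trivializationAt F V x).linearMapAt ℝ b ∘ₗ D.incl b

/-- At the base point the trivialization cancels against its inverse, and then so does each
inclusion against the retraction. This makes `trans x x` invertible near `x`. -/
theorem trans_self (x : B) : D.trans x x x = LinearMap.id := by
  have hx := FiberBundle.mem_baseSet_trivializationAt F V x
  ext v
  simp [trans, modelRetr, localIdem, modelIncl, hx, D.retr_incl]

/-- The smooth idempotent is applied to the local section that is constantly `v` in the frame at
`x`, and the result is read in the trivialization at `y`. -/
theorem contMDiffAt_localIdem [ContMDiffVectorBundle n F V IB] {x y b : B}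
    (hx : b ∈ (trivializationAt F V x).baseSet) (hy : b ∈ (trivializationAt F V y).baseSet) (v : F) :
    ContMDiffAt IB 𝓘(ℝ, F) n (fun b => D.localIdem x y b v) b := by
  have h₁ : ContMDiffAt IB (IB.prod 𝓘(ℝ, F)) n
      (fun b => (trivializationAt F V x).toOpenPartialHomeomorph.symm (b, v)) b :=
    ((trivializationAt F V x).contMDiffOn_symm.contMDiffAt
      ((trivializationAt F V x).open_target.mem_nhds
        ((trivializationAt F V x).mem_target.2 hx))).comp b
      (contMDiffAt_id.prodMk contMDiffAt_const)
  have h₂ := D.smooth.contMDiffAt.comp b h₁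
  have h₃ := (((trivializationAt F V y).contMDiffAt_iff (by
    rw [(trivializationAt F V y).mem_source]
    change ((trivializationAt F V x).toOpenPartialHomeomorph.symm (b, v)).proj ∈ _
    rwa [(trivializationAt F V x).proj_symm_apply' hx])).1 h₂).2
  refine h₃.congr_of_eventuallyEq ?_
  -- `symmₗ` and `linearMapAt` take the default value zero off the base sets, so the agreement is
  -- only local.
  filter_upwards [(trivializationAt F V x).open_baseSet.mem_nhds hx,
    (trivializationAt F V y).open_baseSet.mem_nhds hy] with c hcx hcy
  have : (trivializationAt F V x).toOpenPartialHomeomorph.symm (c, v) =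
    ⟨c, (trivializationAt F V x).symm c v⟩ := ((trivializationAt F V x).mk_symm hcx v).symm
  simp only [Function.comp_apply]
  rw [this]
  simp [localIdem, hcx, hcy]

variable [FiniteDimensional ℝ G]

/-- The domain of the coordinates at `x`. -/
def domain (x : B) : Set B :=
  (trivializationAt F V x).baseSet ∩
    {b | IsUnit (D.trans x x b).toContinuousLinearMap}

theorem mem_domain (x : B) : x ∈ D.domain x := by
  refine ⟨FiberBundle.mem_baseSet_trivializationAt F V x, ?_⟩
  rw [Set.mem_ofPred_eq, D.trans_self]
  exact isUnit_one

/-- The inverse of `fib`. -/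
def sect (x b : B) : G →ₗ[ℝ] E b :=
  D.retr b ∘ₗ (trivializationAt F V x).symmₗ ℝ b ∘ₗ D.modelIncl x ∘ₗ
    (Ring.inverse (D.trans x x b).toContinuousLinearMap).toLinearMap

/-- The inner `incl b ∘ retr b` is the idempotent inside `trans`. The case `y = x` shows that `sect`
is a right inverse; general `y` gives the transition functions. -/
theorem fib_sect (x y b : B) (v : G) :
    D.fib y b (D.sect x b v) =
      D.trans x y b (Ring.inverse (D.trans x x b).toContinuousLinearMap v) := rfl

theorem fib_sect_self {x b : B} (hb : b ∈ D.domain x) (v : G) : D.fib x b (D.sect x b v) = v :=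
  (D.fib_sect x x b v).trans
    (congrArg (fun A : G →L[ℝ] G => A v) (Ring.mul_inverse_cancel _ hb.2))

/-- `fib x b` is surjective between spaces of equal finite dimension, so its right inverse is also a
left inverse. -/
theorem sect_fib_self {x b : B} (hb : b ∈ D.domain x) (v : E b) :
    D.sect x b (D.fib x b v) = v := by
  have : FiniteDimensional ℝ (E b) := (D.equiv b).symm.finiteDimensional
  have hs : Function.Surjective (D.fib x b) := fun w => ⟨_, D.fib_sect_self hb w⟩
  have hi := (LinearMap.injective_iff_surjective_of_finrank_eq_finrank
    (D.equiv b).finrank_eq).2 hs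
  exact hi (D.fib_sect_self hb _)

variable [FiniteDimensional ℝ F] [ContMDiffVectorBundle n F V IB]

theorem contMDiffAt_trans {x y b : B} (hx : b ∈ (trivializationAt F V x).baseSet)
    (hy : b ∈ (trivializationAt F V y).baseSet) :
    ContMDiffAt IB 𝓘(ℝ, G →L[ℝ] G) n (fun b => (D.trans x y b).toContinuousLinearMap) b :=
  contMDiffAt_toContinuousLinearMap fun v =>
    (D.modelRetr y).toContinuousLinearMap.contMDiff.contMDiffAt.comp b
      (D.contMDiffAt_localIdem hx hy (D.modelIncl x v))

theorem contMDiffAt_inverse_trans {x b : B} (hb : b ∈ D.domain x) :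
    ContMDiffAt IB 𝓘(ℝ, G →L[ℝ] G) n
      (fun b => Ring.inverse (D.trans x x b).toContinuousLinearMap) b :=
  (D.contMDiffAt_trans hb.1 hb.1).clm_ringInverse hb.2

theorem isOpen_domain (x : B) : IsOpen (D.domain x) :=
  ContinuousOn.isOpen_inter_preimage (f := fun b => (D.trans x x b).toContinuousLinearMap)
    (fun _ hb => (D.contMDiffAt_trans hb hb).continuousAt.continuousWithinAt)
    (trivializationAt F V x).open_baseSet Units.isOpen

/-- The local trivialization of `E` at `x`. -/
def pretrivialization (x : B) : Pretrivialization G (π G E) where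
  toFun p := (p.proj, D.fib x p.proj p.snd)
  invFun p := ⟨p.1, D.sect x p.1 p.2⟩
  source := π G E ⁻¹' D.domain x
  target := D.domain x ×ˢ Set.univ
  map_source' _ hp := ⟨hp, trivial⟩
  map_target' _ hp := hp.1
  left_inv' := by
    rintro ⟨b, v⟩ hb
    simp only [D.sect_fib_self hb]
  right_inv' := by
    rintro ⟨b, v⟩ ⟨hb, -⟩
    simp only [D.fib_sect_self hb]
  open_target := (D.isOpen_domain x).prod isOpen_univ
  baseSet := D.domain x
  open_baseSet := D.isOpen_domain x
  source_eq := rfl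
  target_eq := rfl
  proj_toFun _ _ := rfl

theorem pretrivialization_apply (x b : B) (v : E b) :
    D.pretrivialization x ⟨b, v⟩ = (b, D.fib x b v) := rfl

theorem pretrivialization_symm {x b : B} (hb : b ∈ D.domain x) (v : G) :
    (D.pretrivialization x).symm b v = D.sect x b v := by
  have := (D.pretrivialization x).symm_apply_apply_mk hb (D.sect x b v)
  rwa [pretrivialization_apply, D.fib_sect_self hb] at this

/-- By `fib_sect` the transition function is `trans x y ∘ (trans x x)⁻¹`, a product of smooth
operator-valued functions on the overlap. -/
theorem exists_coordChange (x y : B) :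
    ∃ f : B → G →L[ℝ] G,
      ContMDiffOn IB 𝓘(ℝ, G →L[ℝ] G) n f
        ((D.pretrivialization x).baseSet ∩ (D.pretrivialization y).baseSet) ∧
      ∀ b ∈ (D.pretrivialization x).baseSet ∩ (D.pretrivialization y).baseSet, ∀ v : G,
        f b v = (D.pretrivialization y ⟨b, (D.pretrivialization x).symm b v⟩).2 := by
  refine ⟨fun b => (D.trans x y b).toContinuousLinearMap.comp
    (Ring.inverse (D.trans x x b).toContinuousLinearMap), fun b hb => ?_, fun b hb v => ?_⟩
  · exact ((D.contMDiffAt_trans hb.1.1 hb.2.1).clm_comp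
      (D.contMDiffAt_inverse_trans hb.1)).contMDiffWithinAt
  · rw [D.pretrivialization_symm hb.1]
    rfl

/-- The topology on the fibres of `E`. -/
@[reducible]
def fiberTopology (x : B) : TopologicalSpace (E x) :=
  .induced (fun v => D.pretrivialization x ⟨x, v⟩) inferInstance

/-- The vector bundle structure on `E`. -/
def prebundle : letI := D.fiberTopology; VectorPrebundle ℝ G E :=
  letI := D.fiberTopology
  { pretrivializationAtlas := Set.range D.pretrivialization
    pretrivialization_linear' := by
      rintro _ ⟨x, rfl⟩
      exact ⟨fun b _ => (D.fib x b).isLinear⟩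
    pretrivializationAt := D.pretrivialization
    mem_base_pretrivializationAt := D.mem_domain
    pretrivialization_mem_atlas := fun x => ⟨x, rfl⟩
    exists_coordChange := by
      rintro _ ⟨x, rfl⟩ _ ⟨y, rfl⟩
      obtain ⟨f, hf, h⟩ := D.exists_coordChange x y
      exact ⟨f, hf.continuousOn, h⟩
    -- The topology on each fibre was defined as the one induced by this very chart.
    totalSpaceMk_isInducing := fun _ => ⟨rfl⟩ }

theorem prebundle_isContMDiff :
    letI := D.fiberTopology
    D.prebundle.IsContMDiff IB n := by
  let := D.fiberTopology
  constructor
  rintro _ ⟨x, rfl⟩ _ ⟨y, rfl⟩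
  exact D.exists_coordChange x y

/-- The inclusion of the bundle `E` in `V` is smooth. -/
theorem contMDiff_incl :
    letI := D.fiberTopology
    letI := D.prebundle.totalSpaceTopology
    letI := D.prebundle.toFiberBundle
    ContMDiff (IB.prod 𝓘(ℝ, G)) (IB.prod 𝓘(ℝ, F)) n
      (fun p : TotalSpace G E => (⟨p.proj, D.incl p.proj p.snd⟩ : TotalSpace F V)) := by
  let := D.fiberTopology
  let := D.prebundle.totalSpaceTopology
  let := D.prebundle.toFiberBundle
  intro p
  rw [contMDiffAt_totalSpace]
  have hproj : ContMDiffAt (IB.prod 𝓘(ℝ, G)) IB n (π G E) p := contMDiffAt_proj E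
  refine ⟨hproj, ?_⟩
  have hid : ContMDiffAt (IB.prod 𝓘(ℝ, G)) (IB.prod 𝓘(ℝ, G)) n (id : TotalSpace G E → _) p :=
    contMDiffAt_id
  have hw := (contMDiffAt_totalSpace.1 hid).2
  have hb : p.proj ∈ D.domain p.proj := D.mem_domain _
  have hk : ContMDiffAt IB 𝓘(ℝ, F →L[ℝ] F) n
      (fun b => (D.localIdem p.proj p.proj b).toContinuousLinearMap) p.proj :=
    contMDiffAt_toContinuousLinearMap fun v => D.contMDiffAt_localIdem hb.1 hb.1 v
  -- Writing a vector as `sect` of its fibre coordinate, its inclusion reads as `localIdem ∘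
  -- modelIncl ∘ (trans)⁻¹` applied to that coordinate.
  have hv := (hk.comp p hproj).clm_apply
    ((D.modelIncl p.proj).toContinuousLinearMap.contMDiff.contMDiffAt.comp p
      (((D.contMDiffAt_inverse_trans hb).comp p hproj).clm_apply hw))
  refine hv.congr_of_eventuallyEq ?_
  filter_upwards [hproj.continuousAt ((D.isOpen_domain p.proj).mem_nhds hb)] with q hq
  have hq' : q.proj ∈ D.domain p.proj := hq
  have h := D.sect_fib_self hq' q.snd
  conv_lhs => rw [← h]
  symm
  change (trivializationAt F V p.proj).linearMapAt ℝ q.proj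
    (D.incl q.proj (D.sect p.proj q.proj (D.fib p.proj q.proj q.snd))) = _
  rw [(trivializationAt F V p.proj).coe_linearMapAt_of_mem hq'.1]

/-- The retraction of `V` to the bundle `E` is smooth. -/
theorem contMDiff_retr :
    letI := D.fiberTopology
    letI := D.prebundle.totalSpaceTopology
    letI := D.prebundle.toFiberBundle
    ContMDiff (IB.prod 𝓘(ℝ, F)) (IB.prod 𝓘(ℝ, G)) n
      (fun p : TotalSpace F V => (⟨p.proj, D.retr p.proj p.snd⟩ : TotalSpace G E)) := by
  let := D.fiberTopology
  let := D.prebundle.totalSpaceTopology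
  let := D.prebundle.toFiberBundle
  intro p
  rw [contMDiffAt_totalSpace]
  have hproj : ContMDiffAt (IB.prod 𝓘(ℝ, F)) IB n (π F V) p := contMDiffAt_proj V
  refine ⟨hproj, ?_⟩
  have hw := (contMDiffAt_totalSpace.1 (D.smooth.contMDiffAt (x := p))).2
  -- The fibre coordinate of the retraction is the fixed map `modelRetr` applied to the coordinate
  -- of the idempotent, which is smooth by assumption.
  refine ((D.modelRetr p.proj).toContinuousLinearMap.contMDiff.contMDiffAt.comp p
    hw).congr_of_eventuallyEq ?_
  filter_upwards [hproj.continuousAt ((trivializationAt F V p.proj).open_baseSet.mem_nhds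
    (FiberBundle.mem_baseSet_trivializationAt F V p.proj))] with q hq
  have hq' : q.proj ∈ (trivializationAt F V p.proj).baseSet := hq
  change D.modelRetr p.proj ((trivializationAt F V p.proj).linearMapAt ℝ q.proj
    (D.incl q.proj (D.retr q.proj q.snd))) = _
  rw [(trivializationAt F V p.proj).coe_linearMapAt_of_mem hq']
  rfl

end SmoothRetract

end Retract

/-! ### Partial normalizations of a simplicial vector space -/

section PartialNormalization

variable (V : SimplicialObject (ModuleCat.{0} ℝ))

/-- The common kernel of the face maps `d_j` with `j < k`. -/
def partialKer (n k : ℕ) : Submodule ℝ (V.obj (op ⦋n⦌) : ModuleCat.{0} ℝ) :=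
  match n with
  | 0 => ⊤
  | n + 1 => ⨅ (j : Fin (n + 2)) (_ : j.val < k), LinearMap.ker (V.δ j).hom

theorem mem_partialKer_succ {n k : ℕ} {v : V.obj (op ⦋n + 1⦌)} :
    v ∈ partialKer V (n + 1) k ↔ ∀ j : Fin (n + 2), j.val < k → (V.δ j).hom v = 0 := by
  simp [partialKer]

theorem partialKer_zero (n : ℕ) : partialKer V n 0 = ⊤ := by
  cases n <;> simp [partialKer]

theorem partialKer_self (n : ℕ) : partialKer V n n = normalizedSubmodule V n := by
  cases n with
  | zero => rfl
  | succ n =>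
    ext v
    rw [mem_partialKer_succ, mem_normalizedSubmodule_succ]
    refine ⟨fun h j => h j.castSucc j.isLt, fun h j hj => ?_⟩
    exact h ⟨j, hj⟩

theorem mem_partialKer_succ_succ {n k : ℕ} (hk : k < n + 2) {v : V.obj (op ⦋n + 1⦌)} :
    v ∈ partialKer V (n + 1) (k + 1) ↔
      v ∈ partialKer V (n + 1) k ∧ (V.δ ⟨k, hk⟩).hom v = 0 := by
  rw [mem_partialKer_succ, mem_partialKer_succ]
  refine ⟨fun h => ⟨fun j hj => h j (by omega), h _ (by simp)⟩, fun h j hj => ?_⟩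
  rcases Nat.lt_succ_iff_lt_or_eq.1 hj with hj | hj
  · exact h.1 j hj
  · obtain rfl : j = ⟨k, hk⟩ := Fin.ext hj
    exact h.2

/-- For `j < k` one has `d_j d_k = d_{k-1} d_j`. -/
theorem δ_mem_partialKer {n k : ℕ} (hk : k < n + 1) {v : V.obj (op ⦋n + 1⦌)}
    (hv : v ∈ partialKer V (n + 1) k) :
    (V.δ ⟨k, by omega⟩ : V.obj (op ⦋n + 1⦌) ⟶ V.obj (op ⦋n⦌)).hom v ∈ partialKer V n k := by
  cases n with
  | zero => trivial
  | succ n =>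
    rw [mem_partialKer_succ] at hv ⊢
    intro j hj
    obtain ⟨k, rfl⟩ : ∃ l, k = l + 1 := ⟨k - 1, by omega⟩
    have h := congrArg (fun f => f.hom v)
      (V.δ_comp_δ (i := j) (j := ⟨k, by omega⟩) (Fin.le_def.2 (Nat.lt_succ_iff.1 hj)))
    refine Eq.trans h ?_
    change (V.δ _).hom ((V.δ j.castSucc).hom v) = 0
    rw [hv j.castSucc hj, map_zero]

/-- For `j < k` one has `d_j s_k = s_{k-1} d_j`; in degree `0` there is no such `j`. -/
theorem σ_mem_partialKer {n k : ℕ} (hk : k < n + 1) {v : V.obj (op ⦋n⦌)}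
    (hv : v ∈ partialKer V n k) :
    (V.σ ⟨k, hk⟩ : V.obj (op ⦋n⦌) ⟶ V.obj (op ⦋n + 1⦌)).hom v ∈ partialKer V (n + 1) k := by
  rw [mem_partialKer_succ]
  intro j hj
  cases n with
  | zero => omega
  | succ n =>
    rw [mem_partialKer_succ] at hv
    obtain ⟨k, rfl⟩ : ∃ l, k = l + 1 := ⟨k - 1, by omega⟩
    have h := congrArg (fun f => f.hom v)
      (V.δ_comp_σ_of_le (n := n) (i := ⟨j, by omega⟩) (j := ⟨k, by omega⟩)
        (Fin.le_def.2 (Nat.lt_succ_iff.1 hj)))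
    refine Eq.trans h ?_
    change (V.σ _).hom ((V.δ _).hom v) = 0
    rw [hv ⟨j, by omega⟩ hj, map_zero]

theorem δ_σ_apply {n k : ℕ} (hk : k < n + 1) (v : V.obj (op ⦋n⦌)) :
    (V.δ ⟨k, by omega⟩ : V.obj (op ⦋n + 1⦌) ⟶ V.obj (op ⦋n⦌)).hom
      ((V.σ ⟨k, hk⟩ : V.obj (op ⦋n⦌) ⟶ V.obj (op ⦋n + 1⦌)).hom v) = v :=
  congrArg (fun f => f.hom v) (V.δ_comp_σ_self (i := ⟨k, hk⟩))

/-- `s_k d_k` preserves the kernels of the earlier faces, and `d_k s_k = 1` makes `d_k` vanish on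
the difference. -/
theorem sub_σ_δ_mem_partialKer {n k : ℕ} (hk : k < n + 1) {v : V.obj (op ⦋n + 1⦌)}
    (hv : v ∈ partialKer V (n + 1) k) :
    v - (V.σ ⟨k, hk⟩ : V.obj (op ⦋n⦌) ⟶ V.obj (op ⦋n + 1⦌)).hom
      ((V.δ ⟨k, by omega⟩ : V.obj (op ⦋n + 1⦌) ⟶ V.obj (op ⦋n⦌)).hom v) ∈
        partialKer V (n + 1) (k + 1) := by
  rw [mem_partialKer_succ_succ V (by omega)]
  refine ⟨sub_mem hv (σ_mem_partialKer V hk (δ_mem_partialKer V hk hv)), ?_⟩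
  rw [map_sub, δ_σ_apply, sub_self]

/-- Rank-nullity for the restriction of `d_k`, which is onto because `s_k` is a section. -/
theorem finrank_partialKer_succ {n k : ℕ} (hk : k < n + 1)
    [FiniteDimensional ℝ (V.obj (op ⦋n + 1⦌) : ModuleCat.{0} ℝ)] :
    Module.finrank ℝ (partialKer V n k) + Module.finrank ℝ (partialKer V (n + 1) (k + 1)) =
      Module.finrank ℝ (partialKer V (n + 1) k) := by
  let d : partialKer V (n + 1) k →ₗ[ℝ] partialKer V n k :=
    (V.δ ⟨k, by omega⟩ : V.obj (op ⦋n + 1⦌) ⟶ V.obj (op ⦋n⦌)).hom.restrict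
      fun _ => δ_mem_partialKer V hk
  have hd : Function.Surjective d := fun v =>
    ⟨⟨_, σ_mem_partialKer V hk v.2⟩, Subtype.ext (δ_σ_apply V hk v.1)⟩
  have hker : (LinearMap.ker d).map (partialKer V (n + 1) k).subtype =
      partialKer V (n + 1) (k + 1) := by
    ext v
    rw [mem_partialKer_succ_succ V (by omega)]
    constructor
    · rintro ⟨w, hw, rfl⟩
      exact ⟨w.2, congrArg Subtype.val (LinearMap.mem_ker.1 hw)⟩
    · rintro ⟨h₁, h₂⟩
      exact ⟨⟨v, h₁⟩, LinearMap.mem_ker.2 (Subtype.ext h₂), rfl⟩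
  rw [← d.finrank_range_add_finrank_ker, LinearMap.range_eq_top.2 hd, finrank_top, ← hker,
    Submodule.finrank_map_subtype_eq]

/-- The dimensions of the partial normalizations depend only on those of the `V_n`. -/
theorem exists_finrank_partialKer {ι : Type*} (W : ι → SimplicialObject (ModuleCat.{0} ℝ))
    (r : ℕ → ℕ) [∀ i n, FiniteDimensional ℝ ((W i).obj (op ⦋n⦌) : ModuleCat.{0} ℝ)]
    (hr : ∀ i n, Module.finrank ℝ ((W i).obj (op ⦋n⦌) : ModuleCat.{0} ℝ) = r n) (k : ℕ) :
    ∀ n, k ≤ n → ∃ m, ∀ i, Module.finrank ℝ (partialKer (W i) n k) = m := by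
  induction k with
  | zero =>
    intro n _
    refine ⟨r n, fun i => ?_⟩
    rw [partialKer_zero, finrank_top, hr]
  | succ k ih =>
    intro n hn
    obtain ⟨n, rfl⟩ : ∃ l, n = l + 1 := ⟨n - 1, by omega⟩
    obtain ⟨a, ha⟩ := ih n (by omega)
    obtain ⟨b, hb⟩ := ih (n + 1) (by omega)
    -- The dimension formula reads `a + m = b`, so the truncated subtraction is exact.
    refine ⟨b - a, fun i => ?_⟩
    have := finrank_partialKer_succ (W i) (n := n) (k := k) (by omega)
    rw [ha, hb] at this
    omega

end PartialNormalization

/-! ### Morphisms of smooth vector bundles -/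

namespace VectorBundleOn

section

variable {M N : SmoothMfd.{u}}
  {E : M → Type} [∀ x, AddCommGroup (E x)] [∀ x, Module ℝ (E x)]
  {E' : N → Type} [∀ x, AddCommGroup (E' x)] [∀ x, Module ℝ (E' x)]
  {S : VectorBundleOn M E} {S' : VectorBundleOn N E'}

/-- Trivializations are fibrewise linear over their base sets, so locally the fibre coordinate of
the difference is the difference of the fibre coordinates. -/
theorem IsSmoothMap.sub {f : M → N} {φ ψ : ∀ x, E x →ₗ[ℝ] E' (f x)}
    (hφ : S.IsSmoothMap S' f φ) (hψ : S.IsSmoothMap S' f ψ) :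
    S.IsSmoothMap S' f (fun x => φ x - ψ x) := by
  let := S.fiberTopology
  let := S.totalTopology
  let := S.fiberBundle
  let := S'.fiberTopology
  let := S'.totalTopology
  let := S'.fiberBundle
  have := S'.vectorBundle
  intro p
  have h₁ := contMDiffAt_totalSpace.1 (ContMDiff.contMDiffAt (x := p) hφ)
  have h₂ := contMDiffAt_totalSpace.1 (ContMDiff.contMDiffAt (x := p) hψ)
  refine contMDiffAt_totalSpace.2 ⟨h₁.1, (h₁.2.sub h₂.2).congr_of_eventuallyEq ?_⟩
  let e := trivializationAt (EuclideanSpace ℝ (Fin S'.rank)) E' (f p.proj)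
  filter_upwards [h₁.1.continuousAt (e.open_baseSet.mem_nhds
    (FiberBundle.mem_baseSet_trivializationAt _ E' (f p.proj)))] with q hq
  exact (e.linear ℝ (b := f q.proj) hq).map_sub _ _

theorem IsSmoothMap.const_smul {f : M → N} {φ : ∀ x, E x →ₗ[ℝ] E' (f x)}
    (hφ : S.IsSmoothMap S' f φ) (c : ℝ) : S.IsSmoothMap S' f (fun x => c • φ x) := by
  let := S.fiberTopology
  let := S.totalTopology
  let := S.fiberBundle
  let := S'.fiberTopology
  let := S'.totalTopology
  let := S'.fiberBundle
  have := S'.vectorBundle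
  intro p
  have h₁ := contMDiffAt_totalSpace.1 (ContMDiff.contMDiffAt (x := p) hφ)
  refine contMDiffAt_totalSpace.2 ⟨h₁.1, ((ContinuousLinearMap.lsmul ℝ ℝ c).contMDiff.contMDiffAt.comp p
    h₁.2).congr_of_eventuallyEq ?_⟩
  let e := trivializationAt (EuclideanSpace ℝ (Fin S'.rank)) E' (f p.proj)
  filter_upwards [h₁.1.continuousAt (e.open_baseSet.mem_nhds
    (FiberBundle.mem_baseSet_trivializationAt _ E' (f p.proj)))] with q hq
  exact (e.linear ℝ (b := f q.proj) hq).map_smul c _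

end

section

variable {M : SmoothMfd.{u}}
  {E : M → Type} [∀ x, AddCommGroup (E x)] [∀ x, Module ℝ (E x)]
  {E' : M → Type} [∀ x, AddCommGroup (E' x)] [∀ x, Module ℝ (E' x)]

/-- A family of vector spaces of constant dimension which is a retract of a smooth vector bundle
by a smooth idempotent is a smooth vector bundle. -/
theorem exists_of_retract (T : VectorBundleOn M E') (j : ∀ x, E x →ₗ[ℝ] E' x)
    (q : ∀ x, E' x →ₗ[ℝ] E x) (hqj : ∀ x v, q x (j x v) = v)
    (hP : T.IsSmoothMap T (fun x => x) (fun x => (j x).comp (q x)))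
    [∀ x, FiniteDimensional ℝ (E x)] (r : ℕ) (hr : ∀ x, Module.finrank ℝ (E x) = r) :
    ∃ S : VectorBundleOn M E, S.IsSmoothMap T (fun x => x) j ∧ T.IsSmoothMap S (fun x => x) q := by
  let := T.fiberTopology
  let := T.totalTopology
  let := T.fiberBundle
  have := T.vectorBundle
  have := T.smooth
  let D : SmoothRetract (𝓡 M.dim) ∞ (EuclideanSpace ℝ (Fin T.rank)) E'
      (EuclideanSpace ℝ (Fin r)) E :=
    { incl := j
      retr := q
      retr_incl := hqj
      -- The identifications with the model fibre are chosen pointwise; no regularity in `x` is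
      -- needed.
      equiv := fun x => LinearEquiv.ofFinrankEq _ _ (by rw [hr, finrank_euclideanSpace_fin])
      smooth := hP }
  let S : VectorBundleOn M E :=
    { rank := r
      fiberTopology := D.fiberTopology
      totalTopology := letI := D.fiberTopology; D.prebundle.totalSpaceTopology
      fiberBundle := letI := D.fiberTopology; D.prebundle.toFiberBundle
      vectorBundle := letI := D.fiberTopology; D.prebundle.toVectorBundle
      smooth :=
        letI := D.fiberTopology
        letI := D.prebundle_isContMDiff
        D.prebundle.contMDiffVectorBundle (𝓡 M.dim) }
  exact ⟨S, D.contMDiff_incl, D.contMDiff_retr⟩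

/-- A smooth fibrewise inclusion with a smooth retraction is a subbundle. -/
theorem IsSubbundle.of_retract {S : VectorBundleOn M E} {T : VectorBundleOn M E'}
    {j : ∀ x, E x →ₗ[ℝ] E' x} {q : ∀ x, E' x →ₗ[ℝ] E x} (hqj : ∀ x v, q x (j x v) = v)
    (hj : S.IsSmoothMap T (fun x => x) j) (hq : T.IsSmoothMap S (fun x => x) q) :
    S.IsSubbundle T j where
  injective x := Function.LeftInverse.injective (hqj x)
  isSmoothMap := hj
  isEmbedding := by
    let := S.fiberTopology
    let := S.totalTopology
    let := S.fiberBundle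
    let := T.fiberTopology
    let := T.totalTopology
    let := T.fiberBundle
    refine Topology.IsEmbedding.of_leftInverse (f := T.totalMap S (fun x => x) q) (fun p => ?_)
      (ContMDiff.continuous hq) (ContMDiff.continuous hj)
    exact congrArg (TotalSpace.mk p.proj) (hqj p.proj p.snd)

end

end VectorBundleOn

/-! ### Pulled back tangent bundles -/

namespace SmoothMfd

/-- The pullback of the tangent bundle of `N` along `b : M ⟶ N`. -/
def pullbackTangent {M N : SmoothMfd.{u}} (b : M ⟶ N) :
    VectorBundleOn M (fun x => N.Tan (b.toFun x)) :=
  let f : C^∞⟮𝓡 M.dim, M; 𝓡 N.dim, N⟯ := ⟨b.toFun, b.contMDiff⟩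
  let F := EuclideanSpace ℝ (Fin N.dim)
  let E := (f : M → N) *ᵖ N.Tan
  { rank := N.dim
    fiberTopology := inferInstanceAs (∀ x, TopologicalSpace (E x))
    totalTopology := inferInstanceAs (TopologicalSpace (TotalSpace F E))
    fiberBundle := inferInstanceAs (FiberBundle F E)
    vectorBundle := inferInstanceAs (VectorBundle ℝ F E)
    smooth := inferInstanceAs (ContMDiffVectorBundle ∞ F E (𝓡 M.dim)) }

theorem tangentMap_eq {M N : SmoothMfd.{u}} (f : M ⟶ N) {x : M} {y : N} (h : f.toFun x = y)
    (v : M.Tan x) :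
    tangentMap (𝓡 M.dim) (𝓡 N.dim) f.toFun ⟨x, v⟩ = ⟨y, tangentMapAt f h v⟩ := by
  subst h
  rfl

/-- Trivializations of the pullback are pulled back from `N`, so a vector has the same fibre
coordinate in both bundles. -/
theorem contMDiff_pullbackTangent_lift {M N : SmoothMfd.{u}} (b : M ⟶ N) :
    letI := (pullbackTangent b).fiberTopology
    letI := (pullbackTangent b).totalTopology
    letI := (pullbackTangent b).fiberBundle
    ContMDiff ((𝓡 M.dim).prod 𝓘(ℝ, EuclideanSpace ℝ (Fin (pullbackTangent b).rank))) (𝓡 N.dim).tangent ∞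
      (fun p : (pullbackTangent b).Total =>
        (⟨b.toFun p.proj, p.snd⟩ : TangentBundle (𝓡 N.dim) N)) := by
  let := (pullbackTangent b).fiberTopology
  let := (pullbackTangent b).totalTopology
  let := (pullbackTangent b).fiberBundle
  intro p
  have hid : ContMDiffAt ((𝓡 M.dim).prod 𝓘(ℝ, EuclideanSpace ℝ (Fin (pullbackTangent b).rank)))
    ((𝓡 M.dim).prod 𝓘(ℝ, EuclideanSpace ℝ (Fin (pullbackTangent b).rank))) ∞
    (id : (pullbackTangent b).Total → _) p := contMDiffAt_id
  have h := contMDiffAt_totalSpace.1 hid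
  exact contMDiffAt_totalSpace.2 ⟨b.contMDiff.contMDiffAt.comp p h.1, h.2⟩

/-- Tangent maps are smooth on pulled back tangent bundles. -/
theorem isSmoothMap_tangentMapAt {M N M' N' : SmoothMfd.{u}} (b : M ⟶ N) (b' : M' ⟶ N')
    (g : N ⟶ N') (h : M ⟶ M') (hc : ∀ x, g.toFun (b.toFun x) = b'.toFun (h.toFun x)) :
    (pullbackTangent b).IsSmoothMap (pullbackTangent b') h.toFun
      (fun x => tangentMapAt g (hc x)) := by
  let := (pullbackTangent b).fiberTopology
  let := (pullbackTangent b).totalTopology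
  let := (pullbackTangent b).fiberBundle
  let := (pullbackTangent b').fiberTopology
  let := (pullbackTangent b').totalTopology
  let := (pullbackTangent b').fiberBundle
  intro p
  have hproj : ContMDiffAt ((𝓡 M.dim).prod 𝓘(ℝ, EuclideanSpace ℝ (Fin (pullbackTangent b).rank))) (𝓡 M.dim) ∞
      (fun p : (pullbackTangent b).Total => p.proj) p := contMDiffAt_proj _
  have ht := ((g.contMDiff.contMDiff_tangentMap (m := ∞) le_rfl).comp
    (contMDiff_pullbackTangent_lift b)).contMDiffAt (x := p)
  have e : (tangentMap (𝓡 N.dim) (𝓡 N'.dim) g.toFun) ∘ (fun p : (pullbackTangent b).Total =>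
        (⟨b.toFun p.proj, p.snd⟩ : TangentBundle (𝓡 N.dim) N)) =
      fun p => ⟨b'.toFun (h.toFun p.proj), tangentMapAt g (hc p.proj) p.snd⟩ :=
    funext fun p => tangentMap_eq g (hc p.proj) p.snd
  rw [e] at ht
  -- The fibre coordinate is that of the tangent map into `TN'`; smoothness of the base component
  -- comes from `h`.
  exact contMDiffAt_totalSpace.2
    ⟨h.contMDiff.contMDiffAt.comp p hproj, (contMDiffAt_totalSpace.1 ht).2⟩

end SmoothMfd

namespace SMfd

instance (X : SMfd.{u}) (x : X.base) (k : SimplexCategoryᵒᵖ) :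
    FiniteDimensional ℝ ((X.tangentAt x).obj k : ModuleCat.{0} ℝ) :=
  inferInstanceAs (FiniteDimensional ℝ (EuclideanSpace ℝ (Fin (X.obj k).dim)))

theorem finrank_tangentAt (X : SMfd.{u}) (x : X.base) (k : SimplexCategoryᵒᵖ) :
    Module.finrank ℝ ((X.tangentAt x).obj k : ModuleCat.{0} ℝ) = (X.obj k).dim :=
  finrank_euclideanSpace_fin (𝕜 := ℝ)

/-- The restricted tangent bundle unfolds to the pullback along `baseMap`, and structure maps
commute with the `baseMap`s over the identity of `X_0`. -/
theorem isSmoothMap_tangentAt_map (X : SMfd.{u}) {n m : ℕ} (θ : op ⦋n⦌ ⟶ op ⦋m⦌) :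
    (X.restrictedTangentBundle n).IsSmoothMap (X.restrictedTangentBundle m) (fun x => x)
      (fun x => ((X.tangentAt x).map θ).hom) :=
  SmoothMfd.isSmoothMap_tangentMapAt (X.baseMap (op ⦋n⦌)) (X.baseMap (op ⦋m⦌)) (X.map θ)
    (𝟙 X.base) (X.baseMap_map θ)

theorem isSmoothMap_tangentAtMap {X Y : SMfd.{u}} (f : X ⟶ Y) (n : ℕ) :
    (X.restrictedTangentBundle n).IsSmoothMap (Y.restrictedTangentBundle n)
      (f.app (op ⦋0⦌)).toFun (fun x => ((tangentAtMap f x).app (op ⦋n⦌)).hom) :=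
  SmoothMfd.isSmoothMap_tangentMapAt (X.baseMap (op ⦋n⦌)) (Y.baseMap (op ⦋n⦌)) (f.app (op ⦋n⦌))
    (f.app (op ⦋0⦌)) (baseMap_naturality f (op ⦋n⦌))

/-- There is a smooth projection of `TX_n|_{X_0}` to each partial normalization. -/
theorem exists_projection_partialKer (X : SMfd.{u}) (n k : ℕ) (hk : k ≤ n) :
    ∃ P : ∀ x, ((X.tangentAt x).obj (op ⦋n⦌) : ModuleCat.{0} ℝ) →ₗ[ℝ]
        ((X.tangentAt x).obj (op ⦋n⦌) : ModuleCat.{0} ℝ),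
      (X.restrictedTangentBundle n).IsSmoothMap (X.restrictedTangentBundle n) (fun x => x) P ∧
      (∀ x v, P x v ∈ partialKer (X.tangentAt x) n k) ∧
      ∀ x, ∀ v ∈ partialKer (X.tangentAt x) n k, P x v = v := by
  induction k with
  | zero =>
    refine ⟨fun _ => LinearMap.id, VectorBundleOn.isSmoothMap_id _, fun x v => ?_, fun _ _ _ => rfl⟩
    rw [partialKer_zero]
    trivial
  | succ k ih =>
    obtain ⟨P, hP, hmem, hid⟩ := ih (by omega)
    obtain ⟨n, rfl⟩ : ∃ l, n = l + 1 := ⟨n - 1, by omega⟩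
    have hk' : k < n + 1 := hk
    -- The next projection is `(1 - s_k d_k) P`.
    refine ⟨fun x => P x - ((X.tangentAt x).σ ⟨k, hk'⟩).hom ∘ₗ
      ((X.tangentAt x).δ ⟨k, by omega⟩).hom ∘ₗ P x, ?_, fun x v => ?_, fun x v hv => ?_⟩
    · exact hP.sub ((hP.comp (X.isSmoothMap_tangentAt_map _)).comp (X.isSmoothMap_tangentAt_map _))
    · exact sub_σ_δ_mem_partialKer (X.tangentAt x) hk' (hmem x v)
    · rw [mem_partialKer_succ_succ _ (by omega)] at hv
      change P x v - ((X.tangentAt x).σ ⟨k, hk'⟩).hom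
        (((X.tangentAt x).δ ⟨k, by omega⟩).hom (P x v)) = v
      rw [hid x v hv.1, hv.2, map_zero, sub_zero]

/-- The normalized complexes form smooth vector bundles, which are smooth retracts of the
restricted tangent bundles. -/
theorem exists_tangentComplex_bundle (X : SMfd.{u}) (n : ℕ) :
    ∃ (S : VectorBundleOn X.base (fun x => (normalizedComplex.obj (X.tangentAt x)).X n))
      (q : ∀ x, ((X.tangentAt x).obj (op ⦋n⦌) : ModuleCat.{0} ℝ) →ₗ[ℝ]
        (normalizedComplex.obj (X.tangentAt x)).X n),
      (∀ x v, q x (normalizedInclusion (X.tangentAt x) n v) = v) ∧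
      S.IsSmoothMap (X.restrictedTangentBundle n) (fun x => x)
        (fun x => normalizedInclusion (X.tangentAt x) n) ∧
      (X.restrictedTangentBundle n).IsSmoothMap S (fun x => x) q := by
  obtain ⟨P, hP, hmem, hid⟩ := X.exists_projection_partialKer n n le_rfl
  -- A single rank is needed over all of `X_0`, which may be disconnected, so local constancy would
  -- not suffice.
  obtain ⟨r, hr⟩ := exists_finrank_partialKer X.tangentAt (fun n => (X.obj (op ⦋n⦌)).dim)
    (fun x n => X.finrank_tangentAt x _) n n le_rfl
  simp only [partialKer_self] at hmem hid
  have hr' : ∀ x, Module.finrank ℝ (normalizedSubmodule (X.tangentAt x) n) = r := fun x => by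
    rw [← partialKer_self]
    exact hr x
  let q : ∀ x, ((X.tangentAt x).obj (op ⦋n⦌) : ModuleCat.{0} ℝ) →ₗ[ℝ]
      (normalizedComplex.obj (X.tangentAt x)).X n := fun x =>
    (P x).codRestrict (normalizedSubmodule (X.tangentAt x) n) (hmem x)
  have hq : ∀ x v, q x (normalizedInclusion (X.tangentAt x) n v) = v := fun x v =>
    Subtype.ext (hid x _ (Subtype.property (p := (· ∈ normalizedSubmodule (X.tangentAt x) n)) v))
  have : ∀ x, FiniteDimensional ℝ ((normalizedComplex.obj (X.tangentAt x)).X n) := fun x =>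
    inferInstanceAs (FiniteDimensional ℝ (normalizedSubmodule (X.tangentAt x) n))
  obtain ⟨S, h₁, h₂⟩ := VectorBundleOn.exists_of_retract (X.restrictedTangentBundle n)
    (fun x => normalizedInclusion (X.tangentAt x) n) q hq hP r hr'
  exact ⟨S, q, hq, h₁, h₂⟩

end SMfd

end

/-! ### The tangent complex functor -/

theorem mainTheorem4 :
    ∃ S : ∀ X : SMfd.{u}, VBChainStructure (pointwiseTangentComplex.obj X),
      (∀ (X : SMfd.{u}) (n : ℕ), ((S X).bundle n).IsSubbundle (X.restrictedTangentBundle n)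
        (fun x => normalizedInclusion (X.tangentAt x) n)) ∧
      ∃ 𝔗 : SMfd.{u} ⥤ VBChainComplex.{u},
        (∀ X : SMfd.{u}, 𝔗.obj X = ⟨pointwiseTangentComplex.obj X, S X⟩) ∧
        𝔗 ⋙ VBChainComplex.forget = pointwiseTangentComplex := by
  choose S q hqj hj hq using SMfd.exists_tangentComplex_bundle.{u}
  -- Restrictions of smooth bundle maps to the normalized parts are smooth; used both for the
  -- differentials and for the tangent maps of simplicial maps.
  have key : ∀ (X Y : SMfd.{u}) (n m : ℕ) (f : X.base → Y.base)
      (φ : ∀ x, ((X.tangentAt x).obj (op ⦋n⦌) : ModuleCat.{0} ℝ) →ₗ[ℝ]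
        ((Y.tangentAt (f x)).obj (op ⦋m⦌) : ModuleCat.{0} ℝ))
      (ψ : ∀ x, (normalizedComplex.obj (X.tangentAt x)).X n →ₗ[ℝ]
        (normalizedComplex.obj (Y.tangentAt (f x))).X m),
      (X.restrictedTangentBundle n).IsSmoothMap (Y.restrictedTangentBundle m) f φ →
      (∀ x v, normalizedInclusion (Y.tangentAt (f x)) m (ψ x v) =
        φ x (normalizedInclusion (X.tangentAt x) n v)) →
      (S X n).IsSmoothMap (S Y m) f ψ := by
    intro X Y n m f φ ψ hφ h
    have e : ψ = fun x => (q Y m (f x)).comp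
        ((φ x).comp (normalizedInclusion (X.tangentAt x) n)) := by
      funext x
      ext v
      rw [LinearMap.comp_apply, LinearMap.comp_apply, ← h, hqj]
    rw [e]
    exact ((hj X n).comp hφ).comp (hq Y m)
  let T : ∀ X : SMfd.{u}, VBChainStructure (pointwiseTangentComplex.obj X) := fun X =>
    { bundle := S X
      d_smooth := fun n => by
        refine key X X (n + 1) n (fun x => x)
          (fun x => (-1 : ℝ) ^ (n + 1) • ((X.tangentAt x).δ (Fin.last (n + 1))).hom) _
          ((X.isSmoothMap_tangentAt_map _).const_smul _) fun x v => ?_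
        -- The differential of `ChainComplex.of` is defined by a case distinction on degrees, so it
        -- is rewritten before unfolding.
        change normalizedInclusion _ n (((normalizedChain (X.tangentAt x)).d (n + 1) n).hom v) = _
        rw [normalizedChain_d]
        rfl }
  refine ⟨T, fun X n => .of_retract (hqj X n) (hj X n) (hq X n),
    { obj := fun X => ⟨pointwiseTangentComplex.obj X, T X⟩
      map := fun {X Y} f => ⟨pointwiseTangentComplex.map f, fun n =>
        key X Y n n _ _ _ (SMfd.isSmoothMap_tangentAtMap f n) fun _ _ => rfl⟩
      -- Smoothness is a property of a morphism, so the functor laws are inherited from the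
      -- pointwise complex.
      map_id := fun X => VBChainComplex.Hom.ext (pointwiseTangentComplex.map_id X)
      map_comp := fun f g => VBChainComplex.Hom.ext (pointwiseTangentComplex.map_comp f g) },
    fun _ => rfl, rfl⟩
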